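/- Let $X$ be a finite-dimensional real normed space with dual $X^*$, let $\mathbb B_{X^*}$ be the closed unit ball of $X^*$ for the dual norm, and let $f:X\to\mathbb R\cup\{+\infty\}$ be proper and lower semicontinuous, with $S_f:=\{x\in X: f(x)\le 0\}$. For a closed set $A$ in a normed space $E$, $a\in A$ and $\varepsilon\ge 0$, let $$\hat N_\varepsilon(A,a):=\Big\{x^*\in E^*:\ \limsup_{x\to a,\ x\in A\setminus\{a\}}\frac{\langle x^*,x-a\rangle}{\|x-a\|}\le\varepsilon\Big\},$$ and let the limiting (Mordukhovich) normal cone $N(A,a)$ be the set of all $x^*\in E^*$ for which there are $x_n\to a$ with $x_n\in A$, $\varepsilon_n\ge 0$ with $\varepsilon_n\to 0$, and $x_n^*\in\hat N_{\varepsilon_n}(A,x_n)$ with $x_n^*\to x^*$ weak$^*$. With $\operatorname{epi} f:=\{(x,r)\in X\times\mathbb R: f(x)\le r\}$, for a point $x$ with $f(x)<+\infty$ put $$\partial f(x):=\{x^*:(x^*,-1)\in N(\operatorname{epi} f,(x,f(x)))\},\qquad \partial^\infty f(x):=\{x^*:(x^*,0)\in N(\operatorname{epi} f,(x,f(x)))\}.$$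 Theorem. Let $\bar x\in S_f$. Suppose that $f$ is continuous at $\bar x$ and that the inequality $f(x)\le 0$ has a local error bound at $\bar x$, i.e. there are $\kappa,\delta>0$ such that $\inf_{u\in S_f}\|x-u\|\le\kappa\max\{f(x),0\}$ for all $x\in X$ with $\|x-\bar x\|<\delta$. Then there exists $\tau>0$ such that $$N(S_f,\bar x)\cap\mathbb B_{X^*}\subseteq[0,\tau]\,\partial f(\bar x)+\partial^\infty f(\bar x),$$ where $[0,\tau]\,C:=\bigcup_{0\le t\le\tau}tC$ with the convention $0\,C:=\{0\}$ for every $C\subseteq X^*$, including $C=\emptyset$. -/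

import Mathlib

open Filter Topology
open scoped Pointwise

noncomputable section

namespace ErrorBound

section NormalCones

variable {E : Type*} [NormedAddCommGroup E] [NormedSpace ℝ E]

/-- The set of `ε`-normals to `A` at `a`: the functionals `x*` with
`limsup ⟨x*, x - a⟩ / ‖x - a‖ ≤ ε` as `x → a`, `x ∈ A`, `x ≠ a`.  The upper limit is taken in the
extended reals; it is `-∞` if `a` is isolated in `A`. -/
def epsNormals (ε : ℝ) (A : Set E) (a : E) : Set (StrongDual ℝ E) :=
  {φ | limsup (fun x => ((φ (x - a) / ‖x - a‖ : ℝ) : EReal)) (𝓝[A \ {a}] a) ≤ (ε : EReal)}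

/-- The Mordukhovich (limiting) normal cone to `A` at `a`: the sequential weak-star upper limit of
the sets of `ε`-normals to `A` at `x` as `x → a` within `A` and `ε ↓ 0`. -/
def limitingNormalCone (A : Set E) (a : E) : Set (StrongDual ℝ E) :=
  {φ | ∃ (x : ℕ → E) (ε : ℕ → ℝ) (ψ : ℕ → StrongDual ℝ E),
    (∀ n, x n ∈ A) ∧ Tendsto x atTop (𝓝 a) ∧
    (∀ n, 0 ≤ ε n) ∧ Tendsto ε atTop (𝓝 0) ∧
    Tendsto (fun n => StrongDual.toWeakDual (ψ n)) atTop (𝓝 (StrongDual.toWeakDual φ)) ∧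
    ∀ n, ψ n ∈ epsNormals (ε n) A (x n)}

end NormalCones

section Functions

variable {X : Type*} [NormedAddCommGroup X] [NormedSpace ℝ X]

/-- A function with values in `ℝ ∪ {+∞}` that is not identically `+∞`. -/
def IsProper (f : X → EReal) : Prop :=
  (∀ x, f x ≠ ⊥) ∧ ∃ x, f x ≠ ⊤

/-- The epigraph of `f`, a subset of `X × ℝ`. -/
def epigraph (f : X → EReal) : Set (X × ℝ) :=
  {p | f p.1 ≤ (p.2 : EReal)}

/-- The functional `(x*, s) : (x, r) ↦ ⟨x*, x⟩ + s * r` on `X × ℝ`. -/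
def dualPair (φ : StrongDual ℝ X) (s : ℝ) : StrongDual ℝ (X × ℝ) :=
  φ.coprod (s • ContinuousLinearMap.id ℝ ℝ)

/-- The Mordukhovich (limiting) subdifferential of `f` at a point `x` where `f` is finite. -/
def limitingSubdiff (f : X → EReal) (x : X) : Set (StrongDual ℝ X) :=
  {φ | dualPair φ (-1) ∈ limitingNormalCone (epigraph f) (x, (f x).toReal)}

/-- The Mordukhovich singular subdifferential of `f` at a point `x` where `f` is finite. -/
def singularSubdiff (f : X → EReal) (x : X) : Set (StrongDual ℝ X) :=
  {φ | dualPair φ 0 ∈ limitingNormalCone (epigraph f) (x, (f x).toReal)}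

/-- The solution set of the inequality `f x ≤ 0`. -/
def solutionSet (f : X → EReal) : Set X :=
  {x | f x ≤ 0}

/-- The inequality `f x ≤ 0` has a local error bound at `a`:
`d(x, S_f) ≤ τ * max (f x) 0` for all `x` in some open ball around `a`, for some `τ > 0`. -/
def HasLocalErrorBound (f : X → EReal) (a : X) : Prop :=
  ∃ τ δ : ℝ, 0 < τ ∧ 0 < δ ∧ ∀ x ∈ Metric.ball a δ,
    ((Metric.infDist x (solutionSet f) : ℝ) : EReal) ≤ (τ : EReal) * max (f x) 0

end Functions

/-- The product `I C` of a set of scalars and a set of vectors, with the convention `0 ∅ = {0}`: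
the union over `t ∈ I` of `t C`, where `0 C = {0}` for every `C`, also for the empty set. -/
def scaledSet {V : Type*} [AddCommGroup V] [Module ℝ V] (I : Set ℝ) (C : Set V) : Set V :=
  {v | ∃ t ∈ I, (t = 0 ∧ v = 0) ∨ ∃ c ∈ C, v = t • c}

end ErrorBound

end

namespace ErrorBound

section NormalCones

variable {E : Type*} [NormedAddCommGroup E] [NormedSpace ℝ E]

/-! A limiting normal `φ` is a limit of almost normals `ψ` to `S_f` at points `x` near `xbar`. If `f
x < 0`, epigraph points near `(x, f x)` lie over `S_f`, so `(ψ, 0)` is almost normal to the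
epigraph. If `f x = 0`, projecting onto `S_f` and using the error bound with constant `κ` gives `ψ
(y - x) ≤ 2ε‖y - x‖ + 2κ max r 0` on the epigraph near `(x, 0)`. Minimising the gap, with `max r 0`
smoothed, yields an almost normal `(ψ, -t)` with `0 ≤ t ≤ 2κ` at a nearby point
(`exists_dualPair_mem_epsNormals`). Compactness of `[0, 2κ]` and continuity of `f` at `xbar` give a
limiting normal `(φ, -t)` at `(xbar, f xbar)`. Dividing by `t > 0` gives a subgradient; `t = 0`
gives a singular one. -/

theorem mem_epsNormals_of_eventually_le {ε : ℝ} {A : Set E} {a : E} {φ : StrongDual ℝ E}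
    (h : ∀ᶠ x in 𝓝[A] a, φ (x - a) ≤ ε * ‖x - a‖) : φ ∈ epsNormals ε A a := by
  suffices limsup (fun x => ((φ (x - a) / ‖x - a‖ : ℝ) : EReal)) (𝓝[A \ {a}] a) ≤ (ε : EReal) from
    this
  refine limsup_le_of_le (by isBoundedDefault) ?_
  have h' := h.filter_mono (nhdsWithin_mono a (Set.sdiff_subset (s := A) (t := {a})))
  filter_upwards [h', self_mem_nhdsWithin] with x hx hxA
  have hpos : 0 < ‖x - a‖ := norm_pos_iff.2 (sub_ne_zero.2 hxA.2)
  exact EReal.coe_le_coe_iff.2 ((div_le_iff₀ hpos).2 hx)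

theorem exists_radius_of_mem_epsNormals {ε ε' : ℝ} {A : Set E} {a : E} {φ : StrongDual ℝ E}
    (h : φ ∈ epsNormals ε A a) (hε : ε < ε') :
    ∃ ρ > 0, ∀ x ∈ A, ‖x - a‖ < ρ → φ (x - a) ≤ ε' * ‖x - a‖ := by
  have h1 : limsup (fun x => ((φ (x - a) / ‖x - a‖ : ℝ) : EReal)) (𝓝[A \ {a}] a) < (ε' : EReal) :=
    lt_of_le_of_lt h (EReal.coe_lt_coe_iff.2 hε)
  have h2 := eventually_lt_of_limsup_lt h1 (by isBoundedDefault)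
  obtain ⟨ρ, hρ, hball⟩ := Metric.mem_nhdsWithin_iff.1 h2
  refine ⟨ρ, hρ, fun x hx hxρ => ?_⟩
  rcases eq_or_ne x a with rfl | hne
  · simp
  have hpos : 0 < ‖x - a‖ := norm_pos_iff.2 (sub_ne_zero.2 hne)
  have h3 := hball ⟨by rwa [Metric.mem_ball, dist_eq_norm], hx, hne⟩
  exact ((div_lt_iff₀ hpos).1 (EReal.coe_lt_coe_iff.1 h3)).le

theorem zero_mem_limitingNormalCone {A : Set E} {a : E} (ha : a ∈ A) :
    (0 : StrongDual ℝ E) ∈ limitingNormalCone A a :=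
  ⟨fun _ => a, fun _ => 0, fun _ => 0, fun _ => ha, tendsto_const_nhds, fun _ => le_rfl,
    tendsto_const_nhds, tendsto_const_nhds, fun _ =>
      mem_epsNormals_of_eventually_le (Eventually.of_forall fun x => by simp)⟩

theorem mem_limitingNormalCone_of_forall_exists {A : Set E} {a : E} {φ : StrongDual ℝ E}
    (h : ∀ ε > 0, ∃ x ∈ A, ‖x - a‖ ≤ ε ∧ ∃ ψ ∈ epsNormals ε A x, ‖ψ - φ‖ ≤ ε) :
    φ ∈ limitingNormalCone A a := by
  choose! x hxA hx ψ hψ hψφ using h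
  have hu : Tendsto (fun n : ℕ => 1 / ((n : ℝ) + 1)) atTop (𝓝 0) :=
    tendsto_one_div_add_atTop_nhds_zero_nat
  have hpos : ∀ n : ℕ, 0 < 1 / ((n : ℝ) + 1) := fun n => Nat.one_div_pos_of_nat
  refine ⟨fun n => x (1 / ((n : ℝ) + 1)), fun n => 1 / ((n : ℝ) + 1),
    fun n => ψ (1 / ((n : ℝ) + 1)), fun n => hxA _ (hpos n), ?_, fun n => (hpos n).le, hu, ?_,
    fun n => hψ _ (hpos n)⟩
  · exact tendsto_iff_norm_sub_tendsto_zero.2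
      (squeeze_zero (fun _ => norm_nonneg _) (fun n => hx _ (hpos n)) hu)
  · have : Tendsto (fun n : ℕ => ψ (1 / ((n : ℝ) + 1))) atTop (𝓝 φ) :=
      tendsto_iff_norm_sub_tendsto_zero.2
        (squeeze_zero (fun _ => norm_nonneg _) (fun n => hψφ _ (hpos n)) hu)
    exact (NormedSpace.Dual.toWeakDual_continuous.tendsto φ).comp this

theorem tendsto_of_tendsto_toWeakDual [FiniteDimensional ℝ E] {ι : Type*} {l : Filter ι}
    {ψ : ι → StrongDual ℝ E} {φ : StrongDual ℝ E}
    (h : Tendsto (fun i => StrongDual.toWeakDual (ψ i)) l (𝓝 (StrongDual.toWeakDual φ))) :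
    Tendsto ψ l (𝓝 φ) := by
  have : FiniteDimensional ℝ (WeakDual ℝ E) :=
    Module.Finite.equiv (StrongDual.toWeakDual (𝕜 := ℝ) (E := E))
  have hc : Continuous (StrongDual.toWeakDual (𝕜 := ℝ) (E := E)).symm.toLinearMap :=
    LinearMap.continuous_of_finiteDimensional _
  simpa [Function.comp_def] using (hc.tendsto (StrongDual.toWeakDual φ)).comp h

theorem smul_mem_limitingNormalCone {A : Set E} {a : E} {φ : StrongDual ℝ E} {c : ℝ} (hc : 0 < c)
    (h : φ ∈ limitingNormalCone A a) : c • φ ∈ limitingNormalCone A a := by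
  obtain ⟨x, ε, ψ, hxA, hx, hε, hε0, hψ, hN⟩ := h
  -- The slack `1 / (n + 1)` turns the limsup bound into an inequality on a ball.
  refine ⟨x, fun n => c * (ε n + 1 / ((n : ℝ) + 1)), fun n => c • ψ n, hxA, hx,
    fun n => by have := hε n; positivity, ?_, ?_, fun n => ?_⟩
  · simpa using (hε0.add tendsto_one_div_add_atTop_nhds_zero_nat).const_mul c
  · simpa using hψ.const_smul c
  · obtain ⟨ρ, hρ, hball⟩ := exists_radius_of_mem_epsNormals (hN n)
      (lt_add_of_pos_right (ε n) (Nat.one_div_pos_of_nat (α := ℝ) (n := n)))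
    refine mem_epsNormals_of_eventually_le ?_
    filter_upwards [self_mem_nhdsWithin, mem_nhdsWithin_of_mem_nhds (Metric.ball_mem_nhds _ hρ)]
      with y hy hyρ
    have := hball y hy (by rwa [← dist_eq_norm])
    calc (c • ψ n) (y - x n) = c * ψ n (y - x n) := rfl
      _ ≤ c * ((ε n + 1 / ((n : ℝ) + 1)) * ‖y - x n‖) := by gcongr
      _ = _ := by ring

end NormalCones

/-! ### Smoothing and penalisation -/

/-- The smooth approximation `(r + √(r² + μ²)) / 2` of `max r 0` has slope in `[0, 1]` and a
quadratic remainder. -/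
theorem exists_slope_smoothed_posPart {μ : ℝ} (hμ : 0 < μ) (b : ℝ) :
    ∃ t ∈ Set.Icc (0 : ℝ) 1, ∀ r : ℝ,
      (r + √(r ^ 2 + μ ^ 2)) / 2 ≤
        (b + √(b ^ 2 + μ ^ 2)) / 2 + t * (r - b) + (r - b) ^ 2 / (4 * μ) := by
  set B := √(b ^ 2 + μ ^ 2) with hB
  have hB2 : B ^ 2 = b ^ 2 + μ ^ 2 := Real.sq_sqrt (by positivity)
  have hB0 : 0 < B := Real.sqrt_pos.2 (by positivity)
  have hμB : μ ≤ B := Real.le_sqrt_of_sq_le (by nlinarith [sq_nonneg b])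
  have hbB : |b| ≤ B := Real.abs_le_sqrt (by nlinarith [sq_nonneg μ])
  obtain ⟨hb1, hb2⟩ := abs_le.1 hbB
  have h1 : -1 ≤ b / B := by rw [le_div_iff₀ hB0]; linarith
  have h2 : b / B ≤ 1 := by rw [div_le_iff₀ hB0]; linarith
  refine ⟨(1 + b / B) / 2, ⟨by linarith, by linarith⟩, fun r => ?_⟩
  have h3 : √(r ^ 2 + μ ^ 2) ≤ B + b / B * (r - b) + (r - b) ^ 2 / (2 * B) := by
    set R := √(r ^ 2 + μ ^ 2) with hR
    have hR2 : R ^ 2 = r ^ 2 + μ ^ 2 := Real.sq_sqrt (by positivity)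
    -- The left side without `R` is `(B² + R²) / (2B)`, since `R² - B² = r² - b²`.
    have : B + b / B * (r - b) + (r - b) ^ 2 / (2 * B) - R = (B - R) ^ 2 / (2 * B) := by
      field_simp
      nlinarith
    have h0 : 0 ≤ (B - R) ^ 2 / (2 * B) := by positivity
    linarith
  have h4 : (r - b) ^ 2 / (2 * B) ≤ (r - b) ^ 2 / (2 * μ) := by gcongr
  have h5 : (r - b) ^ 2 / (4 * μ) = (r - b) ^ 2 / (2 * μ) / 2 := by field_simp; norm_num
  rw [h5]
  linarith

theorem isClosed_epigraph {X : Type*} [NormedAddCommGroup X] {f : X → EReal}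
    (hf : LowerSemicontinuous f) : IsClosed (epigraph f) :=
  hf.isClosed_epigraph.preimage
    (f := fun p : X × ℝ => ((p.1, (p.2 : EReal)) : X × EReal))
    (continuous_fst.prodMk (continuous_coe_real_ereal.comp continuous_snd))

theorem isClosed_solutionSet {X : Type*} [NormedAddCommGroup X] {f : X → EReal}
    (hf : LowerSemicontinuous f) : IsClosed (solutionSet f) :=
  hf.isClosed_preimage 0

section Functions

variable {X : Type*} [NormedAddCommGroup X] [NormedSpace ℝ X]

theorem dualPair_apply (φ : StrongDual ℝ X) (s : ℝ) (p : X × ℝ) :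
    dualPair φ s p = φ p.1 + s * p.2 := by
  simp [dualPair]

theorem dualPair_sub (φ ψ : StrongDual ℝ X) (s t : ℝ) :
    dualPair φ s - dualPair ψ t = dualPair (φ - ψ) (s - t) := by
  ext p <;> simp [dualPair_apply]

theorem norm_dualPair_le (φ : StrongDual ℝ X) (s : ℝ) : ‖dualPair φ s‖ ≤ ‖φ‖ + |s| := by
  refine ContinuousLinearMap.opNorm_le_bound _ (by positivity) fun p => ?_
  rw [dualPair_apply, add_mul]
  refine (norm_add_le _ _).trans (add_le_add ?_ ?_)
  · exact (φ.le_opNorm _).trans (by gcongr; exact norm_fst_le p)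
  · rw [norm_mul]
    gcongr
    · exact le_rfl
    · exact norm_snd_le p

/-- If a functional is locally dominated on a closed set by `c ‖y - x₀‖ + l max r 0`, then nearby
there is an almost normal whose vertical component lies in `[-l, 0]`. -/
theorem exists_dualPair_mem_epsNormals [FiniteDimensional ℝ X] {C : Set (X × ℝ)} (hC : IsClosed C)
    {x₀ : X} (hx₀ : (x₀, (0 : ℝ)) ∈ C) {ψ : StrongDual ℝ X} {c l ρ ε : ℝ} (hc : 0 ≤ c)
    (hl : 0 < l) (hρ : 0 < ρ) (hε : 0 < ε)
    (h : ∀ p ∈ C, ‖p - (x₀, 0)‖ ≤ ρ → ψ (p.1 - x₀) ≤ c * ‖p.1 - x₀‖ + l * max p.2 0) :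
    ∃ p ∈ C, ‖p - (x₀, 0)‖ ≤ ε ∧ ∃ t ∈ Set.Icc 0 l,
      dualPair ψ (-t) ∈ epsNormals (c + 2 * ε) C p := by
  have : ProperSpace X := FiniteDimensional.proper ℝ X
  set p₀ : X × ℝ := (x₀, 0) with hp₀
  -- Here `l * (μ / 2)` is the value at `p₀` of the function `g` minimised below, and `g p ≥ ε‖p -
  -- p₀‖`; so the minimiser is `ε`-close to `p₀` and interior to the `ρ`-ball.
  obtain ⟨μ, hμ, hμε⟩ : ∃ μ > 0, l * (μ / 2) ≤ ε * min ε (ρ / 2) :=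
    ⟨ε * min ε (ρ / 2) / l, by positivity, by
      have : 0 < ε * min ε (ρ / 2) := by positivity
      have e : l * (ε * min ε (ρ / 2) / l / 2) = ε * min ε (ρ / 2) / 2 := by field_simp
      linarith⟩
  set s : ℝ → ℝ := fun r => (r + √(r ^ 2 + μ ^ 2)) / 2 with hs
  have hs0 : s 0 = μ / 2 := by simp [hs, Real.sqrt_sq hμ.le]
  have hsle : ∀ r, max r 0 ≤ s r := fun r => by
    have h1 : |r| ≤ √(r ^ 2 + μ ^ 2) := Real.abs_le_sqrt (by nlinarith [sq_nonneg μ])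
    obtain ⟨h2, h3⟩ := abs_le.1 h1
    simp only [hs]
    exact max_le (by linarith) (by linarith)
  set g : X × ℝ → ℝ := fun p => -ψ (p.1 - x₀) + c * ‖p.1 - x₀‖ + l * s p.2 + ε * ‖p - p₀‖ with hg
  have hgc : Continuous g := by
    simp only [hg, hs]
    fun_prop
  have hK : IsCompact (C ∩ Metric.closedBall p₀ ρ) := (isCompact_closedBall p₀ ρ).inter_left hC
  obtain ⟨p, ⟨hpC, hpρ⟩, hmin⟩ := hK.exists_isMinOn
    ⟨p₀, hx₀, Metric.mem_closedBall_self hρ.le⟩ hgc.continuousOn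
  rw [Metric.mem_closedBall, dist_eq_norm] at hpρ
  have hgp₀ : g p₀ = l * (μ / 2) := by simp [hg, hp₀, hs0]
  have hgp : ε * ‖p - p₀‖ ≤ g p := by
    have h1 := h p hpC hpρ
    have h2 := mul_le_mul_of_nonneg_left (hsle p.2) hl.le
    simp only [hg]
    linarith
  have hnear : ‖p - p₀‖ ≤ min ε (ρ / 2) := by
    have h1 : g p ≤ g p₀ := hmin ⟨hx₀, Metric.mem_closedBall_self hρ.le⟩
    exact le_of_mul_le_mul_left (hgp.trans (h1.trans (hgp₀.le.trans hμε))) hε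
  obtain ⟨t, ⟨ht0, ht1⟩, ht⟩ := exists_slope_smoothed_posPart hμ p.2
  refine ⟨p, hpC, hnear.trans (min_le_left _ _), l * t,
    ⟨by positivity, mul_le_of_le_one_right hl.le ht1⟩, mem_epsNormals_of_eventually_le ?_⟩
  -- The second radius makes the quadratic remainder at most `ε‖q - p‖`; the term `ε‖· - p₀‖` of `g`
  -- costs the other `ε`.
  have hη : 0 < min (ρ / 2) (ε * (4 * μ) / l) := by positivity
  filter_upwards [self_mem_nhdsWithin, mem_nhdsWithin_of_mem_nhds (Metric.ball_mem_nhds p hη)]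
    with q hq hqp
  rw [Metric.mem_ball, dist_eq_norm] at hqp
  obtain ⟨hq1, hq2⟩ := lt_min_iff.1 hqp
  have hqρ : ‖q - p₀‖ ≤ ρ := by
    have h1 := norm_sub_le_norm_sub_add_norm_sub q p p₀
    have h2 := hnear.trans (min_le_right _ _)
    linarith
  have hgq : g p ≤ g q := hmin ⟨hq, by rwa [Metric.mem_closedBall, dist_eq_norm]⟩
  have hψ : ψ (q.1 - x₀) - ψ (p.1 - x₀) = ψ (q.1 - p.1) := by
    rw [← map_sub, sub_sub_sub_cancel_right]
  have hfst : ‖q.1 - p.1‖ ≤ ‖q - p‖ := norm_fst_le (q - p)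
  have hsnd : |q.2 - p.2| ≤ ‖q - p‖ := norm_snd_le (q - p)
  have h1 : c * ‖q.1 - x₀‖ ≤ c * ‖q - p‖ + c * ‖p.1 - x₀‖ := by
    rw [← mul_add]
    have := norm_sub_le_norm_sub_add_norm_sub q.1 p.1 x₀
    gcongr
    linarith
  have h2 : ε * ‖q - p₀‖ ≤ ε * ‖q - p‖ + ε * ‖p - p₀‖ := by
    rw [← mul_add]
    gcongr
    exact norm_sub_le_norm_sub_add_norm_sub q p p₀
  have h3 : l * s q.2 ≤ l * s p.2 + l * t * (q.2 - p.2) + l * ((q.2 - p.2) ^ 2 / (4 * μ)) := by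
    have := mul_le_mul_of_nonneg_left (ht q.2) hl.le
    simp only [hs]
    linarith
  have h4 : l * ((q.2 - p.2) ^ 2 / (4 * μ)) ≤ ε * ‖q - p‖ := by
    have h5 : (q.2 - p.2) ^ 2 ≤ ‖q - p‖ * (ε * (4 * μ) / l) := by
      rw [← sq_abs, sq]
      exact mul_le_mul hsnd (hsnd.trans hq2.le) (abs_nonneg _) (norm_nonneg _)
    calc l * ((q.2 - p.2) ^ 2 / (4 * μ)) ≤ l * (‖q - p‖ * (ε * (4 * μ) / l) / (4 * μ)) := by gcongr
      _ = ε * ‖q - p‖ := by field_simp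
  rw [dualPair_apply]
  simp only [hg] at hgq
  simp only [Prod.fst_sub, Prod.snd_sub]
  linarith

/-! ### From the solution set to the epigraph -/

/-- An almost normal to the solution set at a point of strict inequality is a horizontal almost
normal to the epigraph. -/
theorem dualPair_zero_mem_epsNormals {f : X → EReal} {x : X} {a ε ε' : ℝ} {ψ : StrongDual ℝ X}
    (ha : a < 0) (hε : 0 ≤ ε) (hεε' : ε < ε') (hψ : ψ ∈ epsNormals ε (solutionSet f) x) :
    dualPair ψ 0 ∈ epsNormals ε' (epigraph f) (x, a) := by
  obtain ⟨ρ, hρ, hball⟩ := exists_radius_of_mem_epsNormals hψ hεε'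
  refine mem_epsNormals_of_eventually_le ?_
  have hη : 0 < min ρ (-a) := lt_min hρ (neg_pos.2 ha)
  filter_upwards [self_mem_nhdsWithin, mem_nhdsWithin_of_mem_nhds (Metric.ball_mem_nhds _ hη)]
    with q hq hqp
  rw [Metric.mem_ball, dist_eq_norm] at hqp
  obtain ⟨hq1, hq2⟩ := lt_min_iff.1 hqp
  have hfst : ‖q.1 - x‖ ≤ ‖q - (x, a)‖ := norm_fst_le (q - (x, a))
  have hsnd : |q.2 - a| ≤ ‖q - (x, a)‖ := norm_snd_le (q - (x, a))
  have hneg : q.2 ≤ 0 := by linarith [le_abs_self (q.2 - a)]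
  have hqS : f q.1 ≤ 0 := le_trans hq (EReal.coe_nonpos.2 hneg)
  rw [dualPair_apply, zero_mul, add_zero]
  exact (hball q.1 hqS (hfst.trans_lt hq1)).trans
    (mul_le_mul_of_nonneg_left hfst (hε.trans hεε'.le))

/-- An almost normal to the solution set satisfies a penalised inequality along the epigraph, by
the error bound. -/
theorem le_add_mul_max_of_infDist_le [FiniteDimensional ℝ X] {f : X → EReal}
    (hf : LowerSemicontinuous f) {x : X} (hx : x ∈ solutionSet f) {ψ : StrongDual ℝ X}
    {κ ε ρ : ℝ} (hψ2 : ‖ψ‖ ≤ 2) (hε : 0 ≤ ε)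
    (hball : ∀ u ∈ solutionSet f, ‖u - x‖ < ρ → ψ (u - x) ≤ ε * ‖u - x‖)
    {y : X} {r : ℝ} (hy : 2 * ‖y - x‖ < ρ)
    (herr : Metric.infDist y (solutionSet f) ≤ κ * max r 0) :
    ψ (y - x) ≤ 2 * ε * ‖y - x‖ + 2 * κ * max r 0 := by
  have : ProperSpace X := FiniteDimensional.proper ℝ X
  -- Split `y - x` at a nearest point `u`: normality controls `u - x`, the error bound controls `y -
  -- u`.
  obtain ⟨u, hu, hdist⟩ := (isClosed_solutionSet hf).exists_infDist_eq_dist ⟨x, hx⟩ y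
  have h1 : ‖y - u‖ ≤ ‖y - x‖ := by
    rw [← dist_eq_norm, ← dist_eq_norm, ← hdist]
    exact Metric.infDist_le_dist_of_mem hx
  have h2 : ‖u - x‖ ≤ 2 * ‖y - x‖ := by
    have := norm_sub_le_norm_sub_add_norm_sub u y x
    rw [norm_sub_rev u y] at this
    linarith
  have h3 : ψ (y - x) = ψ (u - x) + ψ (y - u) := by
    rw [← map_add]; congr 1; abel
  have h4 : ψ (y - u) ≤ 2 * ‖y - u‖ :=
    (le_abs_self _).trans ((ψ.le_opNorm _).trans (by gcongr))
  have h5 := hball u hu (h2.trans_lt hy)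
  have h6 := mul_le_mul_of_nonneg_left h2 hε
  rw [hdist, dist_eq_norm] at herr
  linarith

theorem infDist_le_of_errorBound {X : Type*} [NormedAddCommGroup X] {f : X → EReal} {κ : ℝ}
    (hκ : 0 < κ) {y : X} {r : ℝ} (hyr : f y ≤ (r : EReal))
    (h : ((Metric.infDist y (solutionSet f) : ℝ) : EReal) ≤ (κ : EReal) * max (f y) 0) :
    Metric.infDist y (solutionSet f) ≤ κ * max r 0 := by
  have h1 : max (f y) 0 ≤ ((max r 0 : ℝ) : EReal) := by
    rw [EReal.coe_strictMono.monotone.map_max]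
    exact max_le_max hyr le_rfl
  have h2 : (κ : EReal) * max (f y) 0 ≤ (κ : EReal) * ((max r 0 : ℝ) : EReal) :=
    mul_le_mul_of_nonneg_left h1 (by exact_mod_cast hκ.le)
  exact_mod_cast h.trans h2

/-- Under the error bound, almost normals to the solution set extend to almost normals to the
epigraph at nearby points, with bounded vertical component. -/
theorem exists_dualPair_mem_epsNormals_epigraph [FiniteDimensional ℝ X] {f : X → EReal}
    (hbot : ∀ x, f x ≠ ⊥) (hf : LowerSemicontinuous f) {a : X} {κ δ : ℝ} (hκ : 0 < κ)
    (herr : ∀ x ∈ Metric.ball a δ,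
      ((Metric.infDist x (solutionSet f) : ℝ) : EReal) ≤ (κ : EReal) * max (f x) 0)
    {x : X} (hx : x ∈ solutionSet f) (hxa : x ∈ Metric.ball a δ) {ψ : StrongDual ℝ X}
    (hψ2 : ‖ψ‖ ≤ 2) {ε η : ℝ} (hε : 0 ≤ ε) (hη : 0 < η)
    (hψ : ψ ∈ epsNormals ε (solutionSet f) x) :
    ∃ p ∈ epigraph f, ‖p - (x, (f x).toReal)‖ ≤ η ∧ ∃ t ∈ Set.Icc 0 (2 * κ),
      dualPair ψ (-t) ∈ epsNormals (2 * (ε + η) + 2 * η) (epigraph f) p := by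
  have hxtop : f x ≠ ⊤ := ne_top_of_le_ne_top EReal.zero_ne_top hx
  have hcoe : ((f x).toReal : EReal) = f x := EReal.coe_toReal hxtop (hbot x)
  have hmem : (x, (f x).toReal) ∈ epigraph f := hcoe.symm.le
  have hle : (f x).toReal ≤ 0 := by
    have : ((f x).toReal : EReal) ≤ 0 := hcoe.le.trans hx
    exact_mod_cast this
  rcases hle.lt_or_eq with hlt | heq
  · refine ⟨_, hmem, by simpa using hη.le, 0, ⟨le_rfl, by positivity⟩, ?_⟩
    rw [neg_zero]
    exact dualPair_zero_mem_epsNormals hlt hε (by linarith) hψ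
  · rw [heq] at hmem ⊢
    obtain ⟨ρ, hρ, hball⟩ := exists_radius_of_mem_epsNormals hψ (lt_add_of_pos_right ε hη)
    have hr : 0 < δ - dist x a := sub_pos.2 hxa
    refine exists_dualPair_mem_epsNormals (ρ := min (ρ / 3) ((δ - dist x a) / 2))
      (isClosed_epigraph hf) hmem (by positivity) (by positivity) (by positivity) hη
      fun p hp hpρ => ?_
    obtain ⟨h1, h2⟩ := le_min_iff.1 hpρ
    have hfst : ‖p.1 - x‖ ≤ ‖p - (x, 0)‖ := norm_fst_le (p - (x, 0))
    have hpa : p.1 ∈ Metric.ball a δ := by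
      have := dist_triangle p.1 x a
      rw [dist_eq_norm p.1 x] at this
      rw [Metric.mem_ball]
      linarith
    exact le_add_mul_max_of_infDist_le hf hx hψ2 (by positivity) hball (by linarith)
      (infDist_le_of_errorBound hκ hp (herr _ hpa))

/-! ### Passage to the limit -/

/-- Limiting normals to the solution set of norm at most one lift to limiting normals to the
epigraph with bounded vertical component. -/
theorem exists_dualPair_mem_limitingNormalCone_epigraph [FiniteDimensional ℝ X] {f : X → EReal}
    (hbot : ∀ x, f x ≠ ⊥) (hf : LowerSemicontinuous f) {a : X} (ha : a ∈ solutionSet f)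
    (hcont : ContinuousAt f a) {κ δ : ℝ} (hκ : 0 < κ) (hδ : 0 < δ)
    (herr : ∀ x ∈ Metric.ball a δ,
      ((Metric.infDist x (solutionSet f) : ℝ) : EReal) ≤ (κ : EReal) * max (f x) 0)
    {φ : StrongDual ℝ X} (hφ : φ ∈ limitingNormalCone (solutionSet f) a) (hφ1 : ‖φ‖ ≤ 1) :
    ∃ t ∈ Set.Icc 0 (2 * κ),
      dualPair φ (-t) ∈ limitingNormalCone (epigraph f) (a, (f a).toReal) := by
  obtain ⟨x, ε, ψ, hxS, hx, hε, hε0, hψ, hN⟩ := hφ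
  have hψ' : Tendsto ψ atTop (𝓝 φ) := tendsto_of_tendsto_toWeakDual hψ
  have hatop : f a ≠ ⊤ := ne_top_of_le_ne_top EReal.zero_ne_top ha
  have hfx : Tendsto (fun n => (f (x n)).toReal) atTop (𝓝 (f a).toReal) :=
    (EReal.tendsto_toReal hatop (hbot a)).comp (hcont.tendsto.comp hx)
  have hp : Tendsto (fun n => (x n, (f (x n)).toReal)) atTop (𝓝 (a, (f a).toReal)) :=
    hx.prodMk_nhds hfx
  have key : ∀ η > 0, ∃ t ∈ Set.Icc 0 (2 * κ), ∃ p ∈ epigraph f, ‖p - (a, (f a).toReal)‖ ≤ η ∧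
      ∃ χ : StrongDual ℝ X, ‖χ - φ‖ ≤ η ∧
        dualPair χ (-t) ∈ epsNormals η (epigraph f) p := by
    intro η hη
    have e1 := hx.eventually (Metric.ball_mem_nhds a hδ)
    have e2 := hψ'.norm.eventually (gt_mem_nhds (hφ1.trans_lt one_lt_two))
    -- With both parameters at most `η / 6`, the tolerance `2 * (ε + η / 6) + 2 * (η / 6)` is at
    -- most `η`.
    have e3 := hε0.eventually (gt_mem_nhds (show 0 < η / 6 by positivity))
    have e4 := hp.eventually (Metric.ball_mem_nhds _ (show 0 < η / 2 by positivity))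
    have e5 := hψ'.eventually (Metric.ball_mem_nhds _ hη)
    obtain ⟨n, h1, h2, h3, h4, h5⟩ := (e1.and (e2.and (e3.and (e4.and e5)))).exists
    obtain ⟨p, hpE, hpx, t, ht, htN⟩ := exists_dualPair_mem_epsNormals_epigraph hbot hf hκ herr
      (hxS n) h1 h2.le (hε n) (show 0 < η / 6 by positivity) (hN n)
    rw [dist_eq_norm] at h4 h5
    refine ⟨t, ht, p, hpE, ?_, ψ n, h5.le, ?_⟩
    · have := norm_sub_le_norm_sub_add_norm_sub p (x n, (f (x n)).toReal) (a, (f a).toReal)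
      linarith
    · exact le_trans htN (EReal.coe_le_coe_iff.2 (by linarith))
  choose! t ht p hpE hpa χ hχ hχN using key
  have hu : Tendsto (fun n : ℕ => 1 / ((n : ℝ) + 1)) atTop (𝓝 0) :=
    tendsto_one_div_add_atTop_nhds_zero_nat
  have hpos : ∀ n : ℕ, 0 < 1 / ((n : ℝ) + 1) := fun n => Nat.one_div_pos_of_nat
  obtain ⟨t₀, ht₀, σ, hσ, hlim⟩ := isCompact_Icc.tendsto_subseq fun n => ht _ (hpos n)
  refine ⟨t₀, ht₀, mem_limitingNormalCone_of_forall_exists fun η hη => ?_⟩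
  have e1 := (hu.comp hσ.tendsto_atTop).eventually (gt_mem_nhds (show 0 < η / 2 by positivity))
  have e2 := hlim.eventually (Metric.ball_mem_nhds _ (show 0 < η / 2 by positivity))
  obtain ⟨n, h1, h2⟩ := (e1.and e2).exists
  simp only [Function.comp_apply, Real.dist_eq] at h1 h2
  set ν : ℝ := 1 / ((σ n : ℝ) + 1)
  have hν : 0 < ν := hpos (σ n)
  refine ⟨p ν, hpE ν hν, (hpa ν hν).trans (by linarith), dualPair (χ ν) (-t ν),
    le_trans (hχN ν hν) (EReal.coe_le_coe_iff.2 (by linarith)), ?_⟩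
  rw [dualPair_sub]
  refine (norm_dualPair_le _ _).trans ?_
  have h3 := hχ ν hν
  rw [neg_sub_neg, abs_sub_comm]
  linarith

theorem dualPair_smul (c : ℝ) (φ : StrongDual ℝ X) (s : ℝ) :
    c • dualPair φ s = dualPair (c • φ) (c * s) := by
  ext p <;> simp [dualPair_apply]

end Functions

end ErrorBound

theorem theorem3p3 {X : Type*} [NormedAddCommGroup X] [NormedSpace ℝ X] [FiniteDimensional ℝ X]
    (f : X → EReal) (hproper : ErrorBound.IsProper f) (hlsc : LowerSemicontinuous f)
    (xbar : X) (hxbar : xbar ∈ ErrorBound.solutionSet f)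
    (herr : ErrorBound.HasLocalErrorBound f xbar) (hcont : ContinuousAt f xbar) :
    ∃ τ : ℝ, 0 < τ ∧
      ErrorBound.limitingNormalCone (ErrorBound.solutionSet f) xbar ∩
          Metric.closedBall (0 : StrongDual ℝ X) 1 ⊆
        ErrorBound.scaledSet (Set.Icc 0 τ) (ErrorBound.limitingSubdiff f xbar) +
          ErrorBound.singularSubdiff f xbar := by
  obtain ⟨κ, δ, hκ, hδ, herr⟩ := herr
  refine ⟨2 * κ, by positivity, fun φ hφ => ?_⟩
  obtain ⟨hφN, hφ1⟩ := hφ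
  rw [mem_closedBall_zero_iff] at hφ1
  obtain ⟨t, ht, hN⟩ := ErrorBound.exists_dualPair_mem_limitingNormalCone_epigraph hproper.1 hlsc
    hxbar hcont hκ hδ herr hφN hφ1
  -- For `t = 0` the subdifferential may be empty, so the convention `0 ∅ = {0}` is needed.
  rcases ht.1.eq_or_lt with rfl | hpos
  · refine Set.mem_add.2 ⟨0, ⟨0, ht, Or.inl ⟨rfl, rfl⟩⟩, φ, ?_, zero_add φ⟩
    rwa [neg_zero] at hN
  · refine Set.mem_add.2 ⟨φ, ⟨t, ht, Or.inr ⟨t⁻¹ • φ, ?_, ?_⟩⟩, 0, ?_, add_zero φ⟩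
    · have := ErrorBound.smul_mem_limitingNormalCone (inv_pos.2 hpos) hN
      rw [ErrorBound.dualPair_smul] at this
      rwa [mul_neg, inv_mul_cancel₀ hpos.ne'] at this
    · rw [smul_smul, mul_inv_cancel₀ hpos.ne', one_smul]
    · have h0 : ErrorBound.dualPair (0 : StrongDual ℝ X) 0 = 0 := by
        ext p <;> simp [ErrorBound.dualPair_apply]
      have hmem : (xbar, (f xbar).toReal) ∈ ErrorBound.epigraph f :=
        (EReal.coe_toReal (ne_top_of_le_ne_top EReal.zero_ne_top hxbar)
        (hproper.1 xbar)).symm.le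
      rw [ErrorBound.singularSubdiff, Set.mem_ofPred_eq, h0]
      exact ErrorBound.zero_mem_limitingNormalCone hmem
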